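/- Let $\Gamma$ be a finite extensive-form game with finite player set $N$, chance player $c$ (put $N_c=N\cup\{c\}$), a finite set $H$ of histories, terminal histories $Z$, payoffs $u^i_z:Z\to\mathbb R$ ($i\in N$), information sets $I^j_i$, $j\in M_i$, with action sets $A(I^j_i)$ ($i\in N_c$), and chance probabilities $f_c$ (equal at histories in the same information set of $c$). Assume perfect recall for every $i\in N_c$. Actions at different information sets are regarded as different. **Sequence form.** For $i\in N_c$ let $\varpi^i_h$ be the sequence of $i$'s actions along the history $h$, let $W^i=\{\varpi^i_h: h\in H\}$, let $\varpi^i_{I^j_i}$ be the sequence leading to $I^j_i$ and $\varpi^i_{I^j_i}a$ its extension by $a\in A(I^j_i)$. Let $M_i(\varpi^i)=\{j\in M_i:\varpi^i_{I^j_i}=\varpi^i\}$ and $D_i=\{(j,a): M_i(\varpi^i_{I^j_i}a)=\emptyset\}$. A realization plan of $i$ is a function $\gamma^i:W^i\to\mathbb R$ with $\gamma^i(\emptyset)=1$, $\sum_{a\in A(I^j_i)}\gamma^i(\varpi^i_{I^j_i}a)=\gamma^i(\varpi^i_{I^j_i})$ and $\gamma^i(\varpi^i_{I^j_i}a)\ge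 0$ for all $j\in M_i$, $a\in A(I^j_i)$; $\Lambda^i$ is the set of these and $\Lambda=\prod_{i\in N}\Lambda^i$. The plan of chance is fixed: $\gamma^c(\varpi^c)$ is the product of the probabilities $f_c$ of the actions in $\varpi^c$. For $\varpi\in\prod_{i\in N_c}W^i$ put $g^i(\varpi)=u^i_z(h)$ if $\varpi=(\varpi^q_h)_{q\in N_c}$ for some $h\in Z$, and $g^i(\varpi)=0$ otherwise. Put $$g^i(\varpi^i,\gamma^{-i})=\sum_{\varpi^{-i}}g^i(\varpi^i,\varpi^{-i})\prod_{q\in N_c\setminus\{i\}}\gamma^q(\varpi^q),\quad g^i(\gamma)=\sum_{\varpi^i\in W^i}\gamma^i(\varpi^i)g^i(\varpi^i,\gamma^{-i}),\quad g^i_m(\varpi^i,\gamma^{-i})=\max_{\tilde\gamma^i\in\Lambda^i,\ \tilde\gamma^i(\varpi^i)=1}g^i(\tilde\gamma^i,\gamma^{-i}).$$ A profile $\gamma^*\in\Lambda$ is a *sequence-form Nash equilibrium* if, for every $i\in N$ and $\varpi^i\in W^i$, $\gamma^{*i}(\varpi^i)=0$ whenever $g^i_m(\varpi^i,\gamma^{*-i})<g^i_m(\tilde\varpi^i,\gamma^{*-i})$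 for some $\tilde\varpi^i\in W^i$. **Normal form.** A pure strategy $s^i\in S^i$ of $i\in N_c$ selects an action $s^i(I^j_i)\in A(I^j_i)$ for every $j\in M_i$; a mixed strategy is a probability vector on $S^i$. For a pure profile $s=(s^q)_{q\in N_c}$, $u^i(s)$ is the sum of $u^i_z(h)$ over the $h\in Z$ all of whose actions are selected by $s$. The mixed strategy of chance is fixed: $\sigma^c(s^c)=\prod_{j\in M_c}f_c(s^c(I^j_c)\mid I^j_c)$. Put $u^i(s^i,\sigma^{-i})=\sum_{s^{-i}}u^i(s^i,s^{-i})\prod_{q\in N_c\setminus\{i\}}\sigma^q(s^q)$. A mixed-strategy profile $\sigma^*=(\sigma^{*i})_{i\in N}$ is a *mixed Nash equilibrium* if, for every $i\in N$ and $s^i\in S^i$, $\sigma^{*i}(s^i)=0$ whenever $u^i(s^i,\sigma^{*-i})<u^i(\tilde s^i,\sigma^{*-i})$ for some $\tilde s^i\in S^i$. A strictly positive $\gamma\in\Lambda$ induces the mixed profile $\sigma(\gamma)$ with $$\sigma^i(\gamma^i;s^i)=\prod_{j\in M_i}\frac{\gamma^i\big(\varpi^i_{I^j_i}s^i(I^j_i)\big)}{\gamma^i(\varpi^i_{I^j_i})}.$$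 **Log-barrier system.** Fix $\gamma^0\in\Lambda$ with all values strictly positive. For $t\in(0,1]$ the system at $t$, in the unknowns $\gamma,\lambda,\nu$ with $\gamma^i(\emptyset)=1$ for all $i\in N$, is $$\begin{aligned} &(1-t)g^i(\varpi^i_{I^j_i}a,\gamma^{-i})+\lambda^i(\varpi^i_{I^j_i}a)-t-\nu^i_{I^j_i}=0, && i\in N,\ (j,a)\in D_i,\\ &(1-t)g^i(\varpi^i_{I^j_i}a,\gamma^{-i})-\nu^i_{I^j_i}+\sum_{j'\in M_i(\varpi^i_{I^j_i}a)}\nu^i_{I^{j'}_i}=0, && i\in N,\ (j,a)\notin D_i,\\ &\sum_{a\in A(I^j_i)}\gamma^i(\varpi^i_{I^j_i}a)-\gamma^i(\varpi^i_{I^j_i})=0, && i\in N,\ j\in M_i,\\ &\gamma^i(\varpi^i_{I^j_i}a)\lambda^i(\varpi^i_{I^j_i}a)=t\,\gamma^{0i}(\varpi^i_{I^j_i}a),\quad \gamma^i(\varpi^i_{I^j_i}a)>0,\quad \lambda^i(\varpi^i_{I^j_i}a)>0, && i\in N,\ (j,a)\in D_i. \end{aligned}$$ **Theorem.** Let $t_k\in(0,1]$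 with $t_k\to0$, and for each $k$ let $\gamma^*(t_k)$ be the $\gamma$-component of a solution $(\gamma,\lambda,\nu)$ of the system at $t=t_k$. Then every limit point of the sequence $(\gamma^*(t_k))_k$ is a sequence-form Nash equilibrium, and every limit point of the sequence of induced mixed profiles $(\sigma(\gamma^*(t_k)))_k$ is a mixed Nash equilibrium. -/

import Mathlib

noncomputable section

/-- The histories of a finite extensive-form game with action labels in `α`: a finite,
prefix-closed set of finite sequences of actions that contains the empty sequence. -/
structure HistoryTree (α : Type*) where
  H : Finset (List α)
  nil_mem : [] ∈ H
  prefix_mem : ∀ h h' : List α, h <+: h' → h' ∈ H → h ∈ H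

namespace HistoryTree

variable {N α : Type*}

/-- `A(h)`, the actions available after `h`. -/
def actions (T : HistoryTree α) (h : List α) : Finset α :=
  T.H.preimage (fun a => h ++ [a]) (fun a _ b _ hab => by simpa using hab)

theorem mem_actions (T : HistoryTree α) {h : List α} {a : α} :
    a ∈ T.actions h ↔ h ++ [a] ∈ T.H := Finset.mem_preimage

variable [DecidableEq N] [DecidableEq α]

/-- `Z`, the terminal histories. -/
def terminal (T : HistoryTree α) : Finset (List α) :=
  T.H.filter (fun h => T.actions h = ∅)

/-- The nonterminal histories after which `q` moves. -/
def decisionNodes (T : HistoryTree α) (P : List α → Option N) (q : Option N) :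
    Finset (List α) :=
  T.H.filter (fun h => T.actions h ≠ ∅ ∧ P h = q)

end HistoryTree

/-- A finite extensive-form game with set of players `N` and action labels in `α`.
The elements of `Option N` are the players `some i` together with the chance player `none`.
`P h` is the mover after the nonterminal history `h` (its values elsewhere are irrelevant),
`info q` is the information partition of the mover `q`,
`chanceProb h a` is the probability `f_c(a | h)`, and `payoff i z` is the payoff of player `i`
at the terminal history `z`. -/
structure ExtensiveGame (N α : Type*) [DecidableEq N] [DecidableEq α]
    extends HistoryTree α where
  P : List α → Option N
  info : (q : Option N) → Finpartition (toHistoryTree.decisionNodes P q)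
  actions_eq : ∀ q, ∀ I ∈ (info q).parts, ∀ h ∈ I, ∀ h' ∈ I,
    toHistoryTree.actions h = toHistoryTree.actions h'
  chanceProb : List α → α → ℝ
  chanceProb_nonneg : ∀ h ∈ toHistoryTree.decisionNodes P none,
    ∀ a ∈ toHistoryTree.actions h, 0 ≤ chanceProb h a
  chanceProb_sum : ∀ h ∈ toHistoryTree.decisionNodes P none,
    ∑ a ∈ toHistoryTree.actions h, chanceProb h a = 1
  chanceProb_eq : ∀ I ∈ (info none).parts, ∀ h ∈ I, ∀ h' ∈ I,
    ∀ a ∈ toHistoryTree.actions h, chanceProb h a = chanceProb h' a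
  payoff : N → List α → ℝ

namespace ExtensiveGame

variable {N α : Type*} [DecidableEq N] [DecidableEq α] (G : ExtensiveGame N α)

/-- The information sets of `q`. -/
abbrev InfoSet (q : Option N) : Type _ := {I : Finset (List α) // I ∈ (G.info q).parts}

variable {G} in
/-- A history in the information set `I`. -/
def InfoSet.rep {q : Option N} (I : G.InfoSet q) : List α :=
  ((G.info q).nonempty_of_mem_parts I.2).choose

variable {G} in
theorem InfoSet.rep_mem {q : Option N} (I : G.InfoSet q) : I.rep ∈ I.1 :=
  ((G.info q).nonempty_of_mem_parts I.2).choose_spec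

/-- `A(I)`, the actions available at the information set `I`; they are the same at all of its
histories. -/
abbrev Act {q : Option N} (I : G.InfoSet q) : Type _ := {a : α // a ∈ G.actions I.rep}

/-- The information set of `q` that contains the history `h`. -/
def infoOf (q : Option N) (h : List α) (hh : h ∈ G.decisionNodes G.P q) : G.InfoSet q :=
  ⟨(G.info q).part h, (G.info q).part_mem.2 hh⟩

/-- The moves of `q` along the continuation (second list) of the history `pre`, in their order. -/
def movesFrom (q : Option N) : List α → List α → List (G.InfoSet q × α)
  | _, [] => []
  | pre, a :: l =>
    if hp : pre ∈ G.decisionNodes G.P q then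
      (G.infoOf q pre hp, a) :: movesFrom q (pre ++ [a]) l
    else movesFrom q (pre ++ [a]) l

/-- The sequence `ϖ^q_h` of the actions that `q` takes along the history `h`. An action is listed
together with the information set at which it is taken, so that actions at different information
sets count as different even when they carry the same label in `α`. -/
def seqOf (q : Option N) (h : List α) : List (G.InfoSet q × α) := G.movesFrom q [] h

/-- Perfect recall (for the players and for chance): two histories in the same information set
give the mover the same record of own information sets visited and own actions taken. -/
def PerfectRecall : Prop :=
  ∀ q, ∀ I ∈ (G.info q).parts, ∀ h ∈ I, ∀ h' ∈ I, G.seqOf q h = G.seqOf q h'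

/-- `W^q`, the sequences of `q`. -/
abbrev Seq (q : Option N) : Type _ :=
  {w : List (G.InfoSet q × α) // w ∈ G.H.image (G.seqOf q)}

instance (q : Option N) : DecidableEq (G.Seq q) := Subtype.instDecidableEq

/-- The empty sequence. -/
def emptySeq (q : Option N) : G.Seq q :=
  ⟨[], Finset.mem_image.2 ⟨[], G.nil_mem, rfl⟩⟩

variable {G} in
theorem InfoSet.rep_mem_H {q : Option N} (I : G.InfoSet q) : I.rep ∈ G.H :=
  (Finset.mem_filter.1 ((G.info q).le I.2 I.rep_mem)).1

/-- `ϖ_I`, the sequence of `q` that leads to the information set `I`. -/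
def infoSeq {q : Option N} (I : G.InfoSet q) : G.Seq q :=
  ⟨G.seqOf q I.rep, Finset.mem_image_of_mem _ I.rep_mem_H⟩

/-- `ϖ_I a`, the sequence that leads to `I` extended by the action `a` at `I`. -/
def extSeq {q : Option N} (I : G.InfoSet q) (a : G.Act I) : G.Seq q :=
  ⟨G.seqOf q (I.rep ++ [a.1]),
    Finset.mem_image_of_mem _ (G.mem_actions.1 a.2)⟩

theorem movesFrom_append (q : Option N) (pre l : List α) (a : α) :
    G.movesFrom q pre (l ++ [a]) =
      G.movesFrom q pre l ++ G.movesFrom q (pre ++ l) [a] := by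
  induction l generalizing pre with
  | nil => simp [movesFrom]
  | cons b l ih =>
    simp only [List.cons_append, movesFrom, ih]
    split <;> simp

/-- `extSeq I a` is indeed `infoSeq I` followed by the action `a` at `I`. -/
theorem extSeq_val {q : Option N} (I : G.InfoSet q) (a : G.Act I) :
    (G.extSeq I a).1 = (G.infoSeq I).1 ++ [(I, a.1)] := by
  have hm : I.rep ∈ G.decisionNodes G.P q := (G.info q).le I.2 I.rep_mem
  have hI : G.infoOf q I.rep hm = I :=
    Subtype.ext ((G.info q).part_eq_of_mem I.2 I.rep_mem)
  simp [extSeq, infoSeq, seqOf, movesFrom_append, movesFrom, hm, hI]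

/-- `M_q(w)`, the information sets of `q` to which the sequence `w` leads. -/
def nextInfo {q : Option N} (w : G.Seq q) : Finset (G.InfoSet q) :=
  Finset.univ.filter (fun J => G.infoSeq J = w)

/-- `(I, a) ∈ D_q`: no information set of `q` follows the sequence `ϖ_I a`. -/
def IsLast {q : Option N} (I : G.InfoSet q) (a : G.Act I) : Prop :=
  G.nextInfo (G.extSeq I a) = ∅

/-! ### The sequence form -/

/-- `Λ^q`, the realization plans of `q`. -/
def plans (q : Option N) : Set (G.Seq q → ℝ) :=
  {p | p (G.emptySeq q) = 1 ∧
    (∀ I : G.InfoSet q, ∑ a : G.Act I, p (G.extSeq I a) - p (G.infoSeq I) = 0) ∧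
    ∀ (I : G.InfoSet q) (a : G.Act I), 0 ≤ p (G.extSeq I a)}

/-- Profiles of real functions on the sequences of the players. -/
abbrev PlanProfile : Type _ := (i : N) → G.Seq (some i) → ℝ

/-- `Λ`, the realization plan profiles. -/
def planProfiles : Set G.PlanProfile := {γ | ∀ i, γ i ∈ G.plans (some i)}

/-- The fixed realization plan `γ^c` of chance. -/
def chancePlan (w : G.Seq none) : ℝ :=
  (w.1.map (fun p => G.chanceProb p.1.rep p.2)).prod

/-- A profile of the players, completed by the realization plan of chance. -/
def withChancePlan (γ : G.PlanProfile) : (q : Option N) → G.Seq q → ℝ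
  | none => G.chancePlan
  | some i => γ i

open Classical in
/-- `g^i(ϖ)` for a sequence profile `ϖ`: the payoff at the terminal history that induces `ϖ`,
and `0` if there is none. -/
def seqProfilePayoff (i : N) (w : (q : Option N) → G.Seq q) : ℝ :=
  if hz : ∃ z ∈ G.terminal, ∀ q, (w q).1 = G.seqOf q z then G.payoff i hz.choose else 0

variable [Fintype N]

/-- `g^i(ϖ^i, γ^{-i})`; the sum over `ϖ^{-i}` is written as the sum over all sequence profiles
whose component at `i` is the given sequence. It does not depend on `γ i`. -/
def seqPayoff (i : N) (v : G.Seq (some i)) (γ : G.PlanProfile) : ℝ :=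
  ∑ w ∈ Finset.univ.filter (fun w : (q : Option N) → G.Seq q => w (some i) = v),
    G.seqProfilePayoff i w *
      ∏ q ∈ Finset.univ.erase (some i), G.withChancePlan γ q (w q)

/-- `g^i(p, γ^{-i})`, the expected payoff of player `i` from the realization plan `p`. -/
def planPayoff (i : N) (p : G.Seq (some i) → ℝ) (γ : G.PlanProfile) : ℝ :=
  ∑ v, p v * G.seqPayoff i v γ

/-- `g^i_m(ϖ^i, γ^{-i})`, the maximal expected payoff of player `i` among the realization plans
that give weight `1` to the sequence `ϖ^i`. (With perfect recall these plans form a nonempty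
compact set, so that the supremum is a maximum.) -/
def maxPayoff (i : N) (v : G.Seq (some i)) (γ : G.PlanProfile) : ℝ :=
  sSup ((fun p => G.planPayoff i p γ) '' {p | p ∈ G.plans (some i) ∧ p v = 1})

/-- Sequence-form Nash equilibrium. -/
def IsSequenceFormNash (γ : G.PlanProfile) : Prop :=
  γ ∈ G.planProfiles ∧
    ∀ (i : N) (v v' : G.Seq (some i)), G.maxPayoff i v γ < G.maxPayoff i v' γ → γ i v = 0

/-- The log-barrier equilibrium system at the parameter `t` with starting point `γ₀`, in the
unknowns `γ`, `lam` (of which only the entries at pairs in `D_i` matter) and `ν`. -/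
structure LogBarrierSystem (γ₀ : G.PlanProfile) (t : ℝ) (γ : G.PlanProfile)
    (lam : (i : N) → (I : G.InfoSet (some i)) → G.Act I → ℝ)
    (ν : (i : N) → G.InfoSet (some i) → ℝ) : Prop where
  root : ∀ i, γ i (G.emptySeq (some i)) = 1
  last : ∀ i (I : G.InfoSet (some i)) (a : G.Act I), G.IsLast I a →
    (1 - t) * G.seqPayoff i (G.extSeq I a) γ + lam i I a - t - ν i I = 0
  notLast : ∀ i (I : G.InfoSet (some i)) (a : G.Act I), ¬ G.IsLast I a →
    (1 - t) * G.seqPayoff i (G.extSeq I a) γ - ν i I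
      + ∑ J ∈ G.nextInfo (G.extSeq I a), ν i J = 0
  flow : ∀ i (I : G.InfoSet (some i)),
    ∑ a : G.Act I, γ i (G.extSeq I a) - γ i (G.infoSeq I) = 0
  compl : ∀ i (I : G.InfoSet (some i)) (a : G.Act I), G.IsLast I a →
    γ i (G.extSeq I a) * lam i I a = t * γ₀ i (G.extSeq I a)
  plan_pos : ∀ i (I : G.InfoSet (some i)) (a : G.Act I), G.IsLast I a →
    0 < γ i (G.extSeq I a)
  lam_pos : ∀ i (I : G.InfoSet (some i)) (a : G.Act I), G.IsLast I a → 0 < lam i I a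

/-! ### The normal form -/

/-- `S^q`, the pure strategies of `q`. -/
abbrev Pure (q : Option N) : Type _ := (I : G.InfoSet q) → G.Act I

/-- Profiles of real functions on the pure strategies of the players. -/
abbrev MixedProfile : Type _ := (i : N) → G.Pure (some i) → ℝ

/-- `Ξ`, the mixed strategy profiles. -/
def mixedProfiles : Set G.MixedProfile :=
  {σ | ∀ i, (∀ s, 0 ≤ σ i s) ∧ ∑ s, σ i s = 1}

/-- The fixed mixed strategy `σ^c` of chance. -/
def chanceMixed (s : G.Pure none) : ℝ :=
  ∏ I : G.InfoSet none, G.chanceProb I.rep (s I).1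

/-- A profile of the players, completed by the mixed strategy of chance. -/
def withChanceMixed (σ : G.MixedProfile) : (q : Option N) → G.Pure q → ℝ
  | none => G.chanceMixed
  | some i => σ i

/-- `1` if the mover at `h` selects the action `a` there under the pure strategy profile `s`, and
`0` otherwise. -/
def selects (s : (q : Option N) → G.Pure q) (h : List α) (a : α) : ℝ :=
  if hh : h ∈ G.decisionNodes G.P (G.P h) then
    if (s (G.P h) (G.infoOf (G.P h) h hh)).1 = a then 1 else 0
  else 0

/-- `u^i(s)`, the payoff of player `i` at the pure strategy profile `s` (chance included). -/
def purePayoff (i : N) (s : (q : Option N) → G.Pure q) : ℝ :=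
  ∑ z ∈ G.terminal, G.payoff i z * ∏ k : Fin z.length, G.selects s (z.take k) (z.get k)

/-- `u^i(s^i, σ^{-i})`; the sum over `s^{-i}` is written as the sum over all pure strategy
profiles whose component at `i` is the given strategy. It does not depend on `σ i`. -/
def mixedPayoff (i : N) (r : G.Pure (some i)) (σ : G.MixedProfile) : ℝ :=
  ∑ s ∈ Finset.univ.filter (fun s : (q : Option N) → G.Pure q => s (some i) = r),
    G.purePayoff i s * ∏ q ∈ Finset.univ.erase (some i), G.withChanceMixed σ q (s q)

/-- Mixed-strategy Nash equilibrium. -/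
def IsMixedNash (σ : G.MixedProfile) : Prop :=
  σ ∈ G.mixedProfiles ∧
    ∀ (i : N) (r r' : G.Pure (some i)), G.mixedPayoff i r σ < G.mixedPayoff i r' σ → σ i r = 0

/-- `σ(γ)`, the mixed strategy profile induced by a strictly positive realization plan
profile `γ`. -/
def inducedMixed (γ : G.PlanProfile) : G.MixedProfile :=
  fun i s => ∏ I : G.InfoSet (some i), γ i (G.extSeq I (s I)) / γ i (G.infoSeq I)

end ExtensiveGame

end

noncomputable section

namespace ExtensiveGame

variable {N α : Type*} [DecidableEq N] [DecidableEq α] (G : ExtensiveGame N α)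

/-! ### Sequences of moves -/

/-! Fix a solution at `t`, a player `i` and a plan `p` of `i`. Weight the equation at each `(I, a)`
by `p (extSeq I a)` and add up. The flow constraints of `p` make the multipliers `ν` telescope, so
that `(1 - t)` times the payoff of `p` is a constant independent of `p` plus the sum of `p * (t -
lam)` over the last moves (`mul_planPayoff_eq`). Comparing `p` with `γ i` cancels the constant.
Since `γ * lam = t * γ₀`, `lam > 0` and `0 ≤ p ≤ 1`, the regret of `γ i` is at most `t` times a
constant (`mul_sub_planPayoff_le`), and a limit point as `t → 0` consists of best responses.

A Kuhn-type decomposition turns this into the two equilibrium notions: each plan is the average of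
pure plans under a product mixed strategy (`sum_planMixed_mul_purePlan`), and an average equals an
upper bound only if every term of positive weight does (`eq_of_sum_mul_eq`). In the normal form the
regret bound is transferred to `σ(γ)` before passing to the limit (`mixedPayoff_inducedMixed`): a
limit plan that vanishes at some information set does not determine the limit of the induced
strategies there. -/

theorem movesFrom_append_list (q : Option N) (pre l l' : List α) :
    G.movesFrom q pre (l ++ l') = G.movesFrom q pre l ++ G.movesFrom q (pre ++ l) l' := by
  induction l generalizing pre with
  | nil => simp [movesFrom]
  | cons b l ih =>
    simp only [List.cons_append, movesFrom, ih]
    split <;> simp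

theorem seqOf_append (q : Option N) (h l : List α) :
    G.seqOf q (h ++ l) = G.seqOf q h ++ G.movesFrom q h l := by
  simpa [seqOf] using G.movesFrom_append_list q [] h l

theorem mem_decisionNodes {q : Option N} {h : List α} :
    h ∈ G.decisionNodes G.P q ↔ h ∈ G.H ∧ G.actions h ≠ ∅ ∧ G.P h = q :=
  Finset.mem_filter

theorem mem_H_of_append {h l : List α} (hl : h ++ l ∈ G.H) : h ∈ G.H :=
  G.prefix_mem h (h ++ l) (List.prefix_append h l) hl

theorem mem_decisionNodes_of_append {h l : List α} {a : α} (hl : h ++ a :: l ∈ G.H) :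
    h ∈ G.decisionNodes G.P (G.P h) := by
  refine G.mem_decisionNodes.2 ⟨G.mem_H_of_append hl, ?_, rfl⟩
  have : a ∈ G.actions h := G.mem_actions.2 (G.mem_H_of_append (l := l) (by simpa using hl))
  exact Finset.ne_empty_of_mem this

theorem mem_infoOf (q : Option N) (h : List α) (hh : h ∈ G.decisionNodes G.P q) :
    h ∈ (G.infoOf q h hh).1 :=
  (G.info q).mem_part hh

theorem actions_infoOf (q : Option N) (h : List α) (hh : h ∈ G.decisionNodes G.P q) :
    G.actions (G.infoOf q h hh).rep = G.actions h :=
  G.actions_eq q _ (G.infoOf q h hh).2 _ (InfoSet.rep_mem _) _ (G.mem_infoOf q h hh)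

instance {q : Option N} (I : G.InfoSet q) : Nonempty (G.Act I) := by
  have hm : I.rep ∈ G.decisionNodes G.P q := (G.info q).le I.2 I.rep_mem
  obtain ⟨a, ha⟩ := Finset.nonempty_iff_ne_empty.2 (G.mem_decisionNodes.1 hm).2.1
  exact ⟨⟨a, ha⟩⟩

variable {G}

theorem PerfectRecall.seqOf_eq (hG : G.PerfectRecall) {q : Option N} {h : List α}
    (hh : h ∈ G.decisionNodes G.P q) :
    G.seqOf q h = (G.infoSeq (G.infoOf q h hh)).1 :=
  hG q _ (G.infoOf q h hh).2 _ (G.mem_infoOf q h hh) _ (InfoSet.rep_mem _)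

/-- Along a history, a move of another player leaves the sequence of `q` unchanged. A move of `q`
extends the sequence of the current node, which by perfect recall is that of the representative of
its information set. -/
theorem PerfectRecall.seq_induction (hG : G.PerfectRecall) {q : Option N}
    {C : G.Seq q → Prop} (nil : C (G.emptySeq q))
    (ext : ∀ I (a : G.Act I), C (G.infoSeq I) → C (G.extSeq I a)) (v : G.Seq q) : C v := by
  have key : ∀ h : List α, ∀ hh : h ∈ G.H,
      C ⟨G.seqOf q h, Finset.mem_image_of_mem _ hh⟩ := by
    intro h
    induction h using List.reverseRecOn with
    | nil => exact fun _ => nil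
    | append_singleton l a ih =>
      intro hh
      have hl := G.mem_H_of_append hh
      by_cases hm : l ∈ G.decisionNodes G.P q
      · have ha : a ∈ G.actions (G.infoOf q l hm).rep := by
          rw [G.actions_infoOf]; exact G.mem_actions.2 hh
        have e1 : (⟨G.seqOf q (l ++ [a]), Finset.mem_image_of_mem _ hh⟩ : G.Seq q) =
            G.extSeq (G.infoOf q l hm) ⟨a, ha⟩ := by
          apply Subtype.ext
          rw [extSeq_val, ← hG.seqOf_eq hm]
          change G.seqOf q (l ++ [a]) = _
          rw [seqOf_append]
          simp [movesFrom, hm]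
        have e2 : (⟨G.seqOf q l, Finset.mem_image_of_mem _ hl⟩ : G.Seq q) =
            G.infoSeq (G.infoOf q l hm) := Subtype.ext (hG.seqOf_eq hm)
        rw [e1]
        exact ext _ _ (e2 ▸ ih hl)
      · have e1 : (⟨G.seqOf q (l ++ [a]), Finset.mem_image_of_mem _ hh⟩ : G.Seq q) =
            ⟨G.seqOf q l, Finset.mem_image_of_mem _ hl⟩ := by
          apply Subtype.ext
          simp [seqOf_append, movesFrom, hm]
        rw [e1]
        exact ih hl
  obtain ⟨w, hw⟩ := v
  obtain ⟨h, hh, rfl⟩ := Finset.mem_image.1 hw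
  exact key h hh

theorem PerfectRecall.prefix_of_mem (hG : G.PerfectRecall) {q : Option N} (v : G.Seq q) :
    ∀ p ∈ v.1, (G.infoSeq p.1).1 ++ [p] <+: v.1 := by
  induction v using hG.seq_induction with
  | nil => simp [emptySeq]
  | ext I a ih =>
    rw [extSeq_val]
    intro p hp
    rcases List.mem_append.1 hp with hp | hp
    · exact (ih p hp).trans (List.prefix_append _ _)
    · obtain rfl := List.mem_singleton.1 hp
      exact List.prefix_rfl

/-- If `I` already occurred in `infoSeq I`, then by `prefix_of_mem` that sequence would have a
prefix longer than itself. -/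
theorem PerfectRecall.nodup_map_fst (hG : G.PerfectRecall) {q : Option N} (v : G.Seq q) :
    (v.1.map Prod.fst).Nodup := by
  induction v using hG.seq_induction with
  | nil => simp [emptySeq]
  | ext I a ih =>
    rw [extSeq_val, List.map_append, List.nodup_append]
    refine ⟨ih, by simp, ?_⟩
    intro J hJ K hK hJK
    obtain rfl : K = I := by simpa using hK
    subst hJK
    obtain ⟨p, hp, rfl⟩ := List.mem_map.1 hJ
    have := (hG.prefix_of_mem _ p hp).length_le
    simp at this

theorem PerfectRecall.mem_actions_of_mem (hG : G.PerfectRecall) {q : Option N} (v : G.Seq q) :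
    ∀ p ∈ v.1, p.2 ∈ G.actions p.1.rep := by
  induction v using hG.seq_induction with
  | nil => simp [emptySeq]
  | ext I a ih =>
    rw [extSeq_val]
    intro p hp
    rcases List.mem_append.1 hp with hp | hp
    · exact ih p hp
    · obtain rfl := List.mem_singleton.1 hp
      exact a.2

theorem extSeq_ne_emptySeq {q : Option N} (I : G.InfoSet q) (a : G.Act I) :
    G.extSeq I a ≠ G.emptySeq q := by
  intro h
  have := congrArg Subtype.val h
  rw [extSeq_val] at this
  simp [emptySeq] at this

theorem extSeq_injective {q : Option N} :
    Function.Injective (fun x : (I : G.InfoSet q) × G.Act I => G.extSeq x.1 x.2) := by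
  rintro ⟨I, a⟩ ⟨J, b⟩ h
  have := congrArg Subtype.val h
  simp only [extSeq_val] at this
  have := (List.append_inj_right' this rfl)
  simp only [List.cons.injEq, Prod.mk.injEq, and_true] at this
  obtain ⟨rfl, h2⟩ := this
  rw [Subtype.ext h2]

/-- Every nonempty sequence has a unique last move, so sequences correspond bijectively to `Option`
of the pairs `(I, a)`. -/
theorem PerfectRecall.sum_seq (hG : G.PerfectRecall) {q : Option N} (c : G.Seq q → ℝ) :
    ∑ v, c v = c (G.emptySeq q) + ∑ I : G.InfoSet q, ∑ a : G.Act I, c (G.extSeq I a) := by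
  have hbij : Function.Bijective (fun o : Option ((I : G.InfoSet q) × G.Act I) =>
      o.elim (G.emptySeq q) (fun x => G.extSeq x.1 x.2)) := by
    constructor
    · rintro (_ | x) (_ | y) h
      · rfl
      · exact absurd h.symm (extSeq_ne_emptySeq _ _)
      · exact absurd h (extSeq_ne_emptySeq _ _)
      · exact congrArg some (extSeq_injective h)
    · intro v
      induction v using hG.seq_induction with
      | nil => exact ⟨none, rfl⟩
      | ext I a _ => exact ⟨some ⟨I, a⟩, rfl⟩
  rw [← hbij.sum_comp, Fintype.sum_option, Fintype.sum_sigma]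
  rfl

/-! ### Realization plans -/

theorem PerfectRecall.plan_nonneg (hG : G.PerfectRecall) {q : Option N} {p : G.Seq q → ℝ}
    (hp : p ∈ G.plans q) (v : G.Seq q) : 0 ≤ p v := by
  induction v using hG.seq_induction with
  | nil => rw [hp.1]; exact zero_le_one
  | ext I a _ => exact hp.2.2 I a

theorem plan_extSeq_le {q : Option N} {p : G.Seq q → ℝ}
    (hp : p ∈ G.plans q) (I : G.InfoSet q) (a : G.Act I) :
    p (G.extSeq I a) ≤ p (G.infoSeq I) := by
  rw [← sub_eq_zero.1 (hp.2.1 I)]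
  exact Finset.single_le_sum (f := fun a => p (G.extSeq I a))
    (fun b _ => hp.2.2 I b) (Finset.mem_univ a)

theorem PerfectRecall.plan_le_one (hG : G.PerfectRecall) {q : Option N} {p : G.Seq q → ℝ}
    (hp : p ∈ G.plans q) (v : G.Seq q) : p v ≤ 1 := by
  induction v using hG.seq_induction with
  | nil => exact hp.1.le
  | ext I a ih => exact (plan_extSeq_le hp I a).trans ih

theorem isClosed_plans (q : Option N) : IsClosed (G.plans q) := by
  simp only [plans, Set.ofPred_and, Set.ofPred_forall]
  refine (isClosed_eq (by fun_prop) (by fun_prop)).inter (IsClosed.inter ?_ ?_)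
  · exact isClosed_iInter fun I => isClosed_eq (by fun_prop) (by fun_prop)
  · exact isClosed_iInter fun I => isClosed_iInter fun a =>
      isClosed_le (by fun_prop) (by fun_prop)

/-- The product of the weights `f` of the moves in a list. -/
def moveWeight {q : Option N} (f : G.InfoSet q → α → ℝ) (l : List (G.InfoSet q × α)) : ℝ :=
  (l.map fun p => f p.1 p.2).prod

theorem moveWeight_extSeq {q : Option N} (f : G.InfoSet q → α → ℝ) (I : G.InfoSet q)
    (a : G.Act I) :
    moveWeight f (G.extSeq I a).1 = moveWeight f (G.infoSeq I).1 * f I a := by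
  simp [moveWeight, extSeq_val]

/-- The weights that a pure strategy gives to moves. -/
def pureWeight {q : Option N} (s : G.Pure q) (I : G.InfoSet q) (a : α) : ℝ :=
  if (s I).1 = a then 1 else 0

/-- The realization plan of a pure strategy. -/
def purePlan {q : Option N} (s : G.Pure q) (v : G.Seq q) : ℝ := moveWeight (pureWeight s) v.1

/-- `f` is a behaviour strategy. -/
structure IsBehaviour {q : Option N} (f : G.InfoSet q → α → ℝ) : Prop where
  nonneg : ∀ (I : G.InfoSet q) (a : G.Act I), 0 ≤ f I a
  sum_eq_one : ∀ I : G.InfoSet q, ∑ a : G.Act I, f I a = 1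

theorem isBehaviour_pureWeight {q : Option N} (s : G.Pure q) : IsBehaviour (pureWeight s) where
  nonneg I a := by unfold pureWeight; split <;> norm_num
  sum_eq_one I := by
    have (a : G.Act I) : pureWeight s I a = if s I = a then 1 else 0 := by
      simp only [pureWeight, Subtype.ext_iff]
    simp [this]

theorem isBehaviour_chance :
    IsBehaviour (fun (I : G.InfoSet none) a => G.chanceProb I.rep a) where
  nonneg I a := G.chanceProb_nonneg _ ((G.info none).le I.2 I.rep_mem) _ a.2
  sum_eq_one I := by
    rw [← G.chanceProb_sum I.rep ((G.info none).le I.2 I.rep_mem)]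
    exact Finset.sum_coe_sort _ _

theorem IsBehaviour.mem_plans (hG : G.PerfectRecall) {q : Option N} {f : G.InfoSet q → α → ℝ}
    (hf : IsBehaviour f) : (fun v : G.Seq q => moveWeight f v.1) ∈ G.plans q := by
  have h0 (v : G.Seq q) : 0 ≤ moveWeight f v.1 := by
    induction v using hG.seq_induction with
    | nil => simp [emptySeq, moveWeight]
    | ext I a ih => rw [moveWeight_extSeq]; exact mul_nonneg ih (hf.nonneg I a)
  refine ⟨by simp [emptySeq, moveWeight], fun I => ?_, fun I a => h0 _⟩
  simp only [moveWeight_extSeq, ← Finset.mul_sum, hf.sum_eq_one, mul_one, sub_self]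

theorem purePlan_mem (hG : G.PerfectRecall) {q : Option N} (s : G.Pure q) :
    purePlan s ∈ G.plans q := (isBehaviour_pureWeight s).mem_plans hG

theorem purePlan_eq_one {q : Option N} {s : G.Pure q} {v : G.Seq q} (h : purePlan s v ≠ 0) :
    purePlan s v = 1 := by
  refine List.prod_eq_one fun x hx => ?_
  obtain ⟨p, hp, rfl⟩ := List.mem_map.1 hx
  by_contra hne
  apply h
  refine List.prod_eq_zero (List.mem_map.2 ⟨p, hp, ?_⟩)
  unfold pureWeight at hne ⊢
  split <;> simp_all

theorem IsBehaviour.sum_prod {q : Option N} {f : G.InfoSet q → α → ℝ} (hf : IsBehaviour f) :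
    ∑ s : G.Pure q, ∏ I, f I (s I) = 1 := by
  rw [← Fintype.piFinset_univ,
    ← Finset.prod_univ_sum (fun I => (Finset.univ : Finset (G.Act I))) (fun I a => f I a)]
  exact Finset.prod_eq_one fun I _ => hf.sum_eq_one I

/-- The mixed strategy of a behaviour strategy realizes the same weights of sequences. -/
theorem IsBehaviour.sum_prod_mul_purePlan (hG : G.PerfectRecall) {q : Option N}
    {f : G.InfoSet q → α → ℝ} (hf : IsBehaviour f) (v : G.Seq q) :
    ∑ s : G.Pure q, (∏ I, f I (s I)) * purePlan s v = moveWeight f v.1 := by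
  -- Grouping the factors by information set makes the summand a product over `I` of functions of `s
  -- I`, so the sum over `s` factorises.
  have hsplit (s : G.Pure q) (l : List (G.InfoSet q × α)) : moveWeight (pureWeight s) l =
      ∏ I, (l.map fun p => if p.1 = I then (if (s I).1 = p.2 then (1 : ℝ) else 0) else 1).prod := by
    induction l with
    | nil => simp [moveWeight]
    | cons p l ih =>
      simp only [moveWeight, List.map_cons, List.prod_cons, Finset.prod_mul_distrib] at ih ⊢
      rw [ih]
      simp [pureWeight]
  have hmain : ∀ l : List (G.InfoSet q × α), (l.map Prod.fst).Nodup →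
      (∀ p ∈ l, p.2 ∈ G.actions p.1.rep) →
      ∏ I : G.InfoSet q, ∑ a : G.Act I, f I a *
        (l.map fun p => if p.1 = I then (if a.1 = p.2 then (1 : ℝ) else 0) else 1).prod =
      moveWeight f l := by
    intro l
    induction l with
    | nil =>
      intros
      simp only [List.map_nil, List.prod_nil, mul_one, hf.sum_eq_one, Finset.prod_const_one,
        moveWeight]
    | cons p l ih =>
      intro hnd hact
      simp only [List.map_cons, List.nodup_cons, List.mem_cons, forall_eq_or_imp] at hnd hact
      have hfac (I : G.InfoSet q) : (∑ a : G.Act I, f I a * ((p :: l).map fun p =>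
            if p.1 = I then (if a.1 = p.2 then (1 : ℝ) else 0) else 1).prod) =
          (if p.1 = I then f p.1 p.2 else 1) * ∑ a : G.Act I, f I a * (l.map fun p =>
            if p.1 = I then (if a.1 = p.2 then (1 : ℝ) else 0) else 1).prod := by
        -- The new move affects only the factor at its own information set. No later move of the
        -- list occurs there, so the inner sum drops from `1` to the weight of that one action.
        by_cases hI : p.1 = I
        · subst hI
          have h1 (a : G.Act p.1) : (l.map fun p' =>
              if p'.1 = p.1 then (if a.1 = p'.2 then (1 : ℝ) else 0) else 1).prod = 1 := by
            refine List.prod_eq_one fun x hx => ?_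
            obtain ⟨p', hp', rfl⟩ := List.mem_map.1 hx
            rw [if_neg]
            intro he
            exact hnd.1 (List.mem_map.2 ⟨p', hp', he⟩)
          have h2 (a : G.Act p.1) : (if a.1 = p.2 then (1 : ℝ) else 0) =
              if a = ⟨p.2, hact.1⟩ then 1 else 0 := by
            simp only [Subtype.ext_iff]
          simp only [List.map_cons, List.prod_cons, h1, hf.sum_eq_one, mul_one, if_true, h2]
          simp
        · simp [hI]
      rw [Finset.prod_congr rfl fun I _ => hfac I, Finset.prod_mul_distrib, ih hnd.2 hact.2]
      simp [moveWeight]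
  rw [← hmain v.1 (hG.nodup_map_fst v) (hG.mem_actions_of_mem v), Finset.prod_univ_sum,
    Fintype.piFinset_univ]
  refine Finset.sum_congr rfl fun s _ => ?_
  rw [purePlan, hsplit, Finset.prod_mul_distrib]

open Classical in
/-- The behaviour strategy of a realization plan, uniform where the plan gives no weight. -/
def planBehaviour {q : Option N} (p : G.Seq q → ℝ) (I : G.InfoSet q) (a : α) : ℝ :=
  if p (G.infoSeq I) = 0 then (Fintype.card (G.Act I) : ℝ)⁻¹
  else if ha : a ∈ G.actions I.rep then p (G.extSeq I ⟨a, ha⟩) / p (G.infoSeq I) else 0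

theorem planBehaviour_of_ne {q : Option N} {p : G.Seq q → ℝ} {I : G.InfoSet q}
    (h : p (G.infoSeq I) ≠ 0) (a : G.Act I) :
    planBehaviour p I a = p (G.extSeq I a) / p (G.infoSeq I) := by
  simp [planBehaviour, h]

theorem isBehaviour_planBehaviour (hG : G.PerfectRecall) {q : Option N} {p : G.Seq q → ℝ}
    (hp : p ∈ G.plans q) : IsBehaviour (planBehaviour p) where
  nonneg I a := by
    by_cases h : p (G.infoSeq I) = 0
    · simp [planBehaviour, h]
    · rw [planBehaviour_of_ne h]
      exact div_nonneg (hp.2.2 I a) (hG.plan_nonneg hp _)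
  sum_eq_one I := by
    by_cases h : p (G.infoSeq I) = 0
    · have : (Fintype.card (G.Act I) : ℝ) ≠ 0 := Nat.cast_ne_zero.2 Fintype.card_ne_zero
      simp only [planBehaviour, h, if_true, Finset.sum_const, nsmul_eq_mul, Finset.card_univ]
      exact mul_inv_cancel₀ this
    · simp only [planBehaviour_of_ne h, ← Finset.sum_div]
      rw [sub_eq_zero.1 (hp.2.1 I), div_self h]

/-- The quotients telescope along a sequence. The uniform convention is harmless: where the plan
gives `I` no weight, it gives none to the extensions either. -/
theorem moveWeight_planBehaviour (hG : G.PerfectRecall) {q : Option N} {p : G.Seq q → ℝ}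
    (hp : p ∈ G.plans q) (v : G.Seq q) : moveWeight (planBehaviour p) v.1 = p v := by
  induction v using hG.seq_induction with
  | nil => rw [hp.1]; simp [emptySeq, moveWeight]
  | ext I a ih =>
    rw [moveWeight_extSeq, ih]
    by_cases h : p (G.infoSeq I) = 0
    · rw [h, zero_mul]
      exact le_antisymm (hp.2.2 I a) (h ▸ plan_extSeq_le hp I a)
    · rw [planBehaviour_of_ne h, mul_div_cancel₀ _ h]

/-- The mixed strategy of a realization plan. -/
def planMixed {q : Option N} (p : G.Seq q → ℝ) (s : G.Pure q) : ℝ :=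
  ∏ I, planBehaviour p I (s I)

theorem planMixed_nonneg (hG : G.PerfectRecall) {q : Option N} {p : G.Seq q → ℝ}
    (hp : p ∈ G.plans q) (s : G.Pure q) : 0 ≤ planMixed p s :=
  Finset.prod_nonneg fun I _ => (isBehaviour_planBehaviour hG hp).nonneg I (s I)

theorem sum_planMixed (hG : G.PerfectRecall) {q : Option N} {p : G.Seq q → ℝ}
    (hp : p ∈ G.plans q) : ∑ s, planMixed p s = 1 :=
  (isBehaviour_planBehaviour hG hp).sum_prod

theorem sum_planMixed_mul_purePlan (hG : G.PerfectRecall) {q : Option N} {p : G.Seq q → ℝ}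
    (hp : p ∈ G.plans q) (v : G.Seq q) : ∑ s, planMixed p s * purePlan s v = p v := by
  rw [← moveWeight_planBehaviour hG hp v]
  exact (isBehaviour_planBehaviour hG hp).sum_prod_mul_purePlan hG v

theorem exists_purePlan_eq_one (hG : G.PerfectRecall) {q : Option N} {p : G.Seq q → ℝ}
    (hp : p ∈ G.plans q) {v : G.Seq q} (hv : p v ≠ 0) :
    ∃ s, planMixed p s ≠ 0 ∧ purePlan s v = 1 := by
  rw [← sum_planMixed_mul_purePlan hG hp v] at hv
  obtain ⟨s, _, hs⟩ := Finset.exists_ne_zero_of_sum_ne_zero hv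
  exact ⟨s, left_ne_zero_of_mul hs, purePlan_eq_one (right_ne_zero_of_mul hs)⟩

/-! ### Expected payoffs as sums over terminal histories -/

theorem mem_H_of_mem_terminal {z : List α} (hz : z ∈ G.terminal) : z ∈ G.H :=
  (Finset.mem_filter.1 hz).1

theorem notMem_terminal_of_append {h l : List α} {a : α} (hl : h ++ a :: l ∈ G.H) :
    h ∉ G.terminal := fun hz =>
  (G.mem_decisionNodes.1 (G.mem_decisionNodes_of_append hl)).2.1 (Finset.mem_filter.1 hz).2

/-- The common node `pre` determines the mover, whose list of moves then reveals the next action;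
terminality excludes that one history properly extends the other. -/
theorem eq_of_movesFrom_eq : ∀ {l l' pre : List α}, pre ++ l ∈ G.terminal →
    pre ++ l' ∈ G.terminal → (∀ q, G.movesFrom q pre l = G.movesFrom q pre l') → l = l' := by
  intro l
  induction l with
  | nil =>
    rintro (_ | ⟨b, l'⟩) pre hl hl' _
    · rfl
    · exact absurd (by simpa using hl) (notMem_terminal_of_append (mem_H_of_mem_terminal hl'))
  | cons a l ih =>
    rintro (_ | ⟨b, l'⟩) pre hl hl' h
    · exact absurd (by simpa using hl') (notMem_terminal_of_append (mem_H_of_mem_terminal hl))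
    · have hm := G.mem_decisionNodes_of_append (mem_H_of_mem_terminal hl)
      obtain rfl : a = b := by
        have := h (G.P pre)
        simp only [movesFrom, hm, dite_true, List.cons.injEq, Prod.mk.injEq, true_and] at this
        exact this.1
      rw [ih (l' := l') (pre := pre ++ [a]) (by simpa using hl) (by simpa using hl')]
      intro q
      have := h q
      simp only [movesFrom] at this
      split at this <;> simpa using this

/-- The sequence of `q` along a terminal history. -/
def terminalSeq (z : G.terminal) (q : Option N) : G.Seq q :=
  ⟨G.seqOf q z, Finset.mem_image_of_mem _ (mem_H_of_mem_terminal z.2)⟩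

theorem terminalSeq_injective :
    Function.Injective (terminalSeq (G := G)) := by
  intro z z' h
  apply Subtype.ext
  exact eq_of_movesFrom_eq (pre := []) z.2 z'.2 fun q => congrArg Subtype.val (congrFun h q)

theorem continuous_withChancePlan (q : Option N) (v : G.Seq q) :
    Continuous fun γ : G.PlanProfile => G.withChancePlan γ q v := by
  cases q with
  | none => exact continuous_const
  | some i =>
    change Continuous fun γ : G.PlanProfile => γ i v
    fun_prop

theorem isClosed_planProfiles : IsClosed G.planProfiles := by
  simp only [planProfiles, Set.ofPred_forall]
  exact isClosed_iInter fun i => (isClosed_plans (some i)).preimage (continuous_apply i)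

theorem isClosed_mixedProfiles : IsClosed G.mixedProfiles := by
  simp only [mixedProfiles, Set.ofPred_forall, Set.ofPred_and]
  refine isClosed_iInter fun i => IsClosed.inter ?_ (isClosed_eq (by fun_prop) (by fun_prop))
  exact isClosed_iInter fun s => isClosed_le (by fun_prop) (by fun_prop)

theorem inducedMixed_eq_planMixed {γ : G.PlanProfile} (hpos : ∀ i v, 0 < γ i v) (i : N) :
    G.inducedMixed γ i = planMixed (γ i) := by
  funext s
  exact Finset.prod_congr rfl fun I _ => (planBehaviour_of_ne (hpos i _).ne' (s I)).symm

theorem inducedMixed_mem (hG : G.PerfectRecall) {γ : G.PlanProfile} (hγ : γ ∈ G.planProfiles)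
    (hpos : ∀ i v, 0 < γ i v) : G.inducedMixed γ ∈ G.mixedProfiles := fun i => by
  rw [inducedMixed_eq_planMixed hpos]
  exact ⟨planMixed_nonneg hG (hγ i), sum_planMixed hG (hγ i)⟩

variable [Fintype N]

/-- Each action along the history is charged to its mover and contributes `1` to everyone else. -/
theorem prod_selects (s : (q : Option N) → G.Pure q) (l : List α) :
    ∀ pre : List α, pre ++ l ∈ G.H →
    ∏ k : Fin l.length, G.selects s (pre ++ l.take k) (l.get k) =
      ∏ q, moveWeight (pureWeight (s q)) (G.movesFrom q pre l) := by
  induction l with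
  | nil => intros; simp [movesFrom, moveWeight]
  | cons a l ih =>
    intro pre hl
    have hm := G.mem_decisionNodes_of_append hl
    have hfac (q : Option N) : moveWeight (pureWeight (s q)) (G.movesFrom q pre (a :: l)) =
        (if q = G.P pre then G.selects s pre a else 1) *
          moveWeight (pureWeight (s q)) (G.movesFrom q (pre ++ [a]) l) := by
      by_cases hq : q = G.P pre
      · subst hq
        simp [movesFrom, hm, selects, moveWeight, pureWeight]
      · have : pre ∉ G.decisionNodes G.P q := fun h => hq (G.mem_decisionNodes.1 h).2.2.symm
        simp [movesFrom, this, hq]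
    rw [Finset.prod_congr rfl fun q _ => hfac q, Finset.prod_mul_distrib,
      ← ih (pre ++ [a]) (by simpa using hl), Finset.prod_ite_eq' Finset.univ (G.P pre)]
    simp only [List.length_cons, Fin.prod_univ_succ, Finset.mem_univ, if_true]
    simp

open Classical in
theorem seqProfilePayoff_eq_sum (i : N) (w : (q : Option N) → G.Seq q) :
    G.seqProfilePayoff i w = ∑ z : G.terminal, if terminalSeq z = w then G.payoff i z else 0 := by
  have hiff (z : G.terminal) : terminalSeq z = w ↔ ∀ q, (w q).1 = G.seqOf q z := by
    simp only [funext_iff, Subtype.ext_iff, terminalSeq, eq_comm]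
  unfold seqProfilePayoff
  split
  · next hz =>
    have hc := hz.choose_spec
    rw [Finset.sum_eq_single ⟨hz.choose, hc.1⟩]
    · rw [if_pos ((hiff _).2 hc.2)]
    · intro z _ hne
      exact if_neg fun h => hne (terminalSeq_injective (h.trans ((hiff ⟨_, hc.1⟩).2 hc.2).symm))
    · simp
  · next hz =>
    refine (Finset.sum_eq_zero fun z _ => if_neg fun h => ?_).symm
    exact hz ⟨z, z.2, (hiff z).1 h⟩

theorem planPayoff_eq_sum_terminal (i : N) (p : G.Seq (some i) → ℝ) (γ : G.PlanProfile) :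
    G.planPayoff i p γ = ∑ z : G.terminal, G.payoff i z * (p (terminalSeq z (some i)) *
      ∏ q ∈ Finset.univ.erase (some i), G.withChancePlan γ q (terminalSeq z q)) := by
  classical
  have h1 : G.planPayoff i p γ = ∑ w : (q : Option N) → G.Seq q, G.seqProfilePayoff i w *
      (p (w (some i)) * ∏ q ∈ Finset.univ.erase (some i), G.withChancePlan γ q (w q)) := by
    rw [← Finset.sum_fiberwise _ (fun w : (q : Option N) → G.Seq q => w (some i))]
    refine Finset.sum_congr rfl fun v _ => ?_
    rw [seqPayoff, Finset.mul_sum]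
    refine Finset.sum_congr rfl fun w hw => ?_
    rw [(Finset.mem_filter.1 hw).2]
    ring
  rw [h1]
  simp only [seqProfilePayoff_eq_sum, Finset.sum_mul, ite_mul, zero_mul]
  rw [Finset.sum_comm]
  simp

/-- Payoffs see a mixed profile only through the weights it realizes on sequences: at each terminal
history the sum over profiles factorises over the players. -/
theorem mixedPayoff_eq_planPayoff (i : N) (r : G.Pure (some i)) (σ : G.MixedProfile)
    (γ : G.PlanProfile)
    (h : ∀ q (v : G.Seq q), ∑ s, G.withChanceMixed σ q s * purePlan s v = G.withChancePlan γ q v) :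
    G.mixedPayoff i r σ = G.planPayoff i (purePlan r) γ := by
  have hpure (s : (q : Option N) → G.Pure q) : G.purePayoff i s =
      ∑ z : G.terminal, G.payoff i z * ∏ q, purePlan (s q) (terminalSeq z q) := by
    rw [purePayoff, ← Finset.sum_coe_sort]
    refine Finset.sum_congr rfl fun z _ => ?_
    congr 1
    exact prod_selects s z [] (by simpa using mem_H_of_mem_terminal z.2)
  have hsplit (F : Option N → ℝ) :
      ∏ q, F q = F (some i) * ∏ q ∈ Finset.univ.erase (some i), F q :=
    (Finset.mul_prod_erase _ _ (Finset.mem_univ _)).symm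
  have hone (z : G.terminal) :
      ∑ s ∈ Finset.univ.filter (fun s : (q : Option N) → G.Pure q => s (some i) = r),
        (∏ q, purePlan (s q) (terminalSeq z q)) *
          ∏ q ∈ Finset.univ.erase (some i), G.withChanceMixed σ q (s q) =
      purePlan r (terminalSeq z (some i)) *
        ∏ q ∈ Finset.univ.erase (some i), G.withChancePlan γ q (terminalSeq z q) := by
    -- The profiles with component `r` at `i` form a box with a singleton side at `i`.
    let Q : (q : Option N) → Finset (G.Pure q) :=
      fun q => if hq : q = some i then {hq ▸ r} else Finset.univ
    have hfilter : Finset.univ.filter (fun s : (q : Option N) → G.Pure q => s (some i) = r) =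
        Fintype.piFinset Q := by
      ext s
      simp only [Finset.mem_filter, Finset.mem_univ, true_and, Fintype.mem_piFinset]
      constructor
      · rintro rfl q
        by_cases hq : q = some i
        · subst hq; simp [Q]
        · simp [Q, hq]
      · intro hs
        simpa [Q] using hs (some i)
    let F : (q : Option N) → G.Pure q → ℝ := fun q x =>
      purePlan x (terminalSeq z q) * if q = some i then 1 else G.withChanceMixed σ q x
    have hF (s : (q : Option N) → G.Pure q) : (∏ q, purePlan (s q) (terminalSeq z q)) *
          ∏ q ∈ Finset.univ.erase (some i), G.withChanceMixed σ q (s q) = ∏ q, F q (s q) := by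
      rw [Finset.prod_mul_distrib,
        hsplit (fun q => if q = some i then 1 else G.withChanceMixed σ q (s q)), if_pos rfl, one_mul]
      congr 1
      exact Finset.prod_congr rfl fun q hq => (if_neg (Finset.ne_of_mem_erase hq)).symm
    rw [Finset.sum_congr rfl fun s _ => hF s, hfilter, ← Finset.prod_univ_sum Q F, hsplit]
    congr 1
    · simp [Q, F]
    · refine Finset.prod_congr rfl fun q hq => ?_
      have hq := Finset.ne_of_mem_erase hq
      rw [← h q]
      simp only [Q, F, hq, dite_false, if_false, mul_comm]
  rw [planPayoff_eq_sum_terminal, mixedPayoff]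
  simp only [hpure, Finset.sum_mul, mul_assoc]
  rw [Finset.sum_comm]
  refine Finset.sum_congr rfl fun z _ => ?_
  rw [← Finset.mul_sum, hone]

theorem continuous_planPayoff (i : N) :
    Continuous fun x : (G.Seq (some i) → ℝ) × G.PlanProfile => G.planPayoff i x.1 x.2 := by
  simp only [planPayoff_eq_sum_terminal]
  refine continuous_finsetSum _ fun z _ => continuous_const.mul (Continuous.mul (by fun_prop) ?_)
  exact continuous_finsetProd _ fun q _ => (continuous_withChancePlan q _).comp continuous_snd

theorem continuous_mixedPayoff (i : N) (r : G.Pure (some i)) :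
    Continuous fun σ : G.MixedProfile => G.mixedPayoff i r σ := by
  refine continuous_finsetSum _ fun s _ => continuous_const.mul ?_
  refine continuous_finsetProd _ fun q _ => ?_
  cases q with
  | none => exact continuous_const
  | some j =>
    change Continuous fun σ : G.MixedProfile => σ j (s (some j))
    fun_prop

theorem planPayoff_eq_sum_planMixed (hG : G.PerfectRecall) {i : N} {p : G.Seq (some i) → ℝ}
    (hp : p ∈ G.plans (some i)) (γ : G.PlanProfile) :
    G.planPayoff i p γ = ∑ s, planMixed p s * G.planPayoff i (purePlan s) γ := by
  simp only [planPayoff, Finset.mul_sum]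
  rw [Finset.sum_comm]
  refine Finset.sum_congr rfl fun v _ => ?_
  rw [← sum_planMixed_mul_purePlan hG hp v, Finset.sum_mul]
  exact Finset.sum_congr rfl fun s _ => mul_assoc _ _ _

theorem mixedPayoff_inducedMixed (hG : G.PerfectRecall) {γ : G.PlanProfile}
    (hγ : γ ∈ G.planProfiles) (hpos : ∀ i v, 0 < γ i v) (i : N) (r : G.Pure (some i)) :
    G.mixedPayoff i r (G.inducedMixed γ) = G.planPayoff i (purePlan r) γ := by
  refine mixedPayoff_eq_planPayoff i r _ γ fun q v => ?_
  cases q with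
  | none => exact isBehaviour_chance.sum_prod_mul_purePlan hG v
  | some j =>
    change ∑ s, G.inducedMixed γ j s * purePlan s v = γ j v
    rw [inducedMixed_eq_planMixed hpos]
    exact sum_planMixed_mul_purePlan hG (hγ j) v

/-! ### Solutions of the log-barrier system -/

namespace LogBarrierSystem

variable {γ₀ γ : G.PlanProfile} {t : ℝ} {lam : (i : N) → (I : G.InfoSet (some i)) → G.Act I → ℝ}
  {ν : (i : N) → G.InfoSet (some i) → ℝ}

/-- The system demands positivity only at last moves. A longest sequence of nonpositive weight would
be neither empty nor last, so by the flow equation its weight would be a sum over longer sequences,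
all of positive weight. -/
theorem pos (hG : G.PerfectRecall) (S : G.LogBarrierSystem γ₀ t γ lam ν) (i : N)
    (v : G.Seq (some i)) : 0 < γ i v := by
  by_contra hv
  obtain ⟨w, hw, hmax⟩ := Finset.exists_max_image
    (Finset.univ.filter fun v : G.Seq (some i) => ¬ 0 < γ i v) (fun v => v.1.length)
    ⟨v, by simpa using hv⟩
  have hw : ¬ 0 < γ i w := (Finset.mem_filter.1 hw).2
  induction w using hG.seq_induction with
  | nil => exact hw (by rw [S.root]; exact one_pos)
  | ext I a _ =>
    by_cases hl : G.IsLast I a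
    · exact hw (S.plan_pos i I a hl)
    · obtain ⟨J, hJ⟩ := Finset.nonempty_iff_ne_empty.2 hl
      have hJ : G.infoSeq J = G.extSeq I a := (Finset.mem_filter.1 hJ).2
      rw [← hJ] at hw hmax
      apply hw
      rw [← sub_eq_zero.1 (S.flow i J)]
      refine Finset.sum_pos (fun b _ => ?_) Finset.univ_nonempty
      by_contra hb
      have := hmax (G.extSeq J b) (by simpa using hb)
      simp [extSeq_val] at this

theorem mem_planProfiles (hG : G.PerfectRecall) (S : G.LogBarrierSystem γ₀ t γ lam ν) :
    γ ∈ G.planProfiles := fun i =>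
  ⟨S.root i, S.flow i, fun _ _ => (S.pos hG i _).le⟩

open Classical in
theorem mul_planPayoff_eq (hG : G.PerfectRecall) (S : G.LogBarrierSystem γ₀ t γ lam ν) {i : N}
    {p : G.Seq (some i) → ℝ} (hp : p ∈ G.plans (some i)) :
    (1 - t) * G.planPayoff i p γ = (1 - t) * G.seqPayoff i (G.emptySeq (some i)) γ
      + ∑ J ∈ G.nextInfo (G.emptySeq (some i)), ν i J
      + ∑ I, ∑ a, p (G.extSeq I a) * if G.IsLast I a then t - lam i I a else 0 := by
  -- Both kinds of equation take one form, since the sum over `nextInfo` is empty at a last move.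
  have hg (I : G.InfoSet (some i)) (a : G.Act I) : (1 - t) * G.seqPayoff i (G.extSeq I a) γ =
      ν i I - ∑ J ∈ G.nextInfo (G.extSeq I a), ν i J
        + if G.IsLast I a then t - lam i I a else 0 := by
    split
    · next h =>
      have h' : G.nextInfo (G.extSeq I a) = ∅ := h
      have := S.last i I a h
      rw [h', Finset.sum_empty]
      linarith
    · next h =>
      have := S.notLast i I a h
      linarith
  -- Double counting: each `J` follows exactly one sequence.
  have hν : ∑ v, p v * ∑ J ∈ G.nextInfo v, ν i J = ∑ J, ν i J * p (G.infoSeq J) := by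
    rw [← Finset.sum_fiberwise _ (fun J => G.infoSeq J)]
    refine Finset.sum_congr rfl fun v _ => ?_
    rw [nextInfo, Finset.mul_sum]
    refine Finset.sum_congr rfl fun J hJ => ?_
    rw [(Finset.mem_filter.1 hJ).2, mul_comm]
  have hflow : ∑ J, ν i J * p (G.infoSeq J) = ∑ J, ∑ a, p (G.extSeq J a) * ν i J := by
    refine Finset.sum_congr rfl fun J _ => ?_
    rw [← sub_eq_zero.1 (hp.2.1 J), ← Finset.sum_mul, mul_comm]
  rw [hflow, hG.sum_seq, hp.1, one_mul] at hν
  have hmain : (1 - t) * ∑ I, ∑ a, p (G.extSeq I a) * G.seqPayoff i (G.extSeq I a) γ =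
      ∑ I, ∑ a, p (G.extSeq I a) * ν i I
      - ∑ I, ∑ a, p (G.extSeq I a) * ∑ J ∈ G.nextInfo (G.extSeq I a), ν i J
      + ∑ I, ∑ a, p (G.extSeq I a) * if G.IsLast I a then t - lam i I a else 0 := by
    simp only [Finset.mul_sum (a := 1 - t), ← Finset.sum_sub_distrib, ← Finset.sum_add_distrib]
    refine Finset.sum_congr rfl fun I _ => Finset.sum_congr rfl fun a _ => ?_
    rw [mul_left_comm, hg]
    ring
  rw [planPayoff, hG.sum_seq, hp.1, one_mul, mul_add, hmain]
  linarith

theorem mul_sub_planPayoff_le (hG : G.PerfectRecall) (S : G.LogBarrierSystem γ₀ t γ lam ν)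
    (hγ₀ : ∀ i v, 0 < γ₀ i v) (ht : 0 ≤ t) {i : N} {p : G.Seq (some i) → ℝ}
    (hp : p ∈ G.plans (some i)) :
    (1 - t) * (G.planPayoff i p γ - G.planPayoff i (γ i) γ) ≤
      t * ∑ I, ∑ a, (1 + γ₀ i (G.extSeq I a)) := by
  classical
  rw [mul_sub, S.mul_planPayoff_eq hG hp, S.mul_planPayoff_eq hG (S.mem_planProfiles hG i),
    add_sub_add_left_eq_sub]
  simp only [Finset.mul_sum, ← Finset.sum_sub_distrib]
  refine Finset.sum_le_sum fun I _ => Finset.sum_le_sum fun a _ => ?_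
  have h0 := hγ₀ i (G.extSeq I a)
  -- A last move contributes `p t - p lam - γ t + t γ₀ ≤ t + t γ₀`; any other contributes `0`.
  split
  · next h =>
    have h1 := S.compl i I a h
    have h2 := mul_nonneg (hp.2.2 I a) (S.lam_pos i I a h).le
    have h3 := mul_le_mul_of_nonneg_left (hG.plan_le_one hp (G.extSeq I a)) ht
    have h4 := mul_nonneg (S.pos hG i (G.extSeq I a)).le ht
    rw [mul_sub, mul_sub, h1]
    linarith
  · rw [mul_zero, mul_zero, sub_zero]
    positivity

end LogBarrierSystem

/-! ### Best responses and equilibria -/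

theorem eq_of_sum_mul_eq {S : Type*} [Fintype S] {w f : S → ℝ} {V : ℝ} (hw : ∀ s, 0 ≤ w s)
    (hsum : ∑ s, w s = 1) (hf : ∀ s, f s ≤ V) (hV : ∑ s, w s * f s = V) {s : S} (hs : w s ≠ 0) :
    f s = V := by
  have h : ∑ s, w s * (V - f s) = 0 := by
    simp only [mul_sub, Finset.sum_sub_distrib, ← Finset.sum_mul, hsum, hV, one_mul, sub_self]
  have := (Finset.sum_eq_zero_iff_of_nonneg
    fun s _ => mul_nonneg (hw s) (sub_nonneg.2 (hf s))).1 h s (Finset.mem_univ s)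
  exact (sub_eq_zero.1 ((mul_eq_zero.1 this).resolve_left hs)).symm

theorem isSequenceFormNash_of_bestResponse (hG : G.PerfectRecall) {γ₀ γ : G.PlanProfile}
    (hγ₀ : γ₀ ∈ G.planProfiles) (hγ₀_pos : ∀ i v, 0 < γ₀ i v) (hγ : γ ∈ G.planProfiles)
    (hbest : ∀ i, ∀ p ∈ G.plans (some i), G.planPayoff i p γ ≤ G.planPayoff i (γ i) γ) :
    G.IsSequenceFormNash γ := by
  refine ⟨hγ, fun i v v' hlt => ?_⟩
  by_contra hv
  refine hlt.not_ge (le_trans (b := G.planPayoff i (γ i) γ) ?_ ?_)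
  -- Positivity of `γ₀` supplies a plan of weight `1` at `v'`; over an empty set `sSup` would
  -- default to `0`.
  · obtain ⟨s, -, hs⟩ := exists_purePlan_eq_one hG (hγ₀ i) (hγ₀_pos i v').ne'
    refine csSup_le ⟨_, _, ⟨purePlan_mem hG s, hs⟩, rfl⟩ ?_
    rintro _ ⟨p, hp, rfl⟩
    exact hbest i p hp.1
  -- Some pure strategy in the support of `γ i` follows `v`, and being in the support of a best
  -- response it attains the overall maximum.
  · obtain ⟨s, hs0, hs⟩ := exists_purePlan_eq_one hG (hγ i) hv
    have := eq_of_sum_mul_eq (planMixed_nonneg hG (hγ i)) (sum_planMixed hG (hγ i))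
      (fun s => hbest i _ (purePlan_mem hG s)) (planPayoff_eq_sum_planMixed hG (hγ i) γ).symm hs0
    refine le_csSup ⟨G.planPayoff i (γ i) γ, ?_⟩ ⟨_, ⟨purePlan_mem hG s, hs⟩, this⟩
    rintro _ ⟨p, hp, rfl⟩
    exact hbest i p hp.1

theorem isMixedNash_of_bestResponse {σ : G.MixedProfile} (hσ : σ ∈ G.mixedProfiles)
    (hbest : ∀ i r, G.mixedPayoff i r σ ≤ ∑ s, σ i s * G.mixedPayoff i s σ) :
    G.IsMixedNash σ := by
  refine ⟨hσ, fun i r r' hlt => ?_⟩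
  by_contra hr
  have := eq_of_sum_mul_eq (hσ i).1 (hσ i).2 (hbest i) rfl hr
  exact hlt.not_ge (this ▸ hbest i r')

end ExtensiveGame

end

open Filter ExtensiveGame in
theorem mainTheorem5 {N α : Type*} [Fintype N] [DecidableEq N] [DecidableEq α]
    (G : ExtensiveGame N α) (hG : G.PerfectRecall)
    (γ₀ : G.PlanProfile) (hγ₀ : γ₀ ∈ G.planProfiles) (hγ₀_pos : ∀ i v, 0 < γ₀ i v)
    (t : ℕ → ℝ) (ht : ∀ k, t k ∈ Set.Ioc (0 : ℝ) 1)
    (ht_lim : Filter.Tendsto t Filter.atTop (nhds 0))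
    (γ : ℕ → G.PlanProfile)
    (hγ : ∀ k, ∃ lam ν, G.LogBarrierSystem γ₀ (t k) (γ k) lam ν) :
    (∀ γs : G.PlanProfile, MapClusterPt γs Filter.atTop γ → G.IsSequenceFormNash γs) ∧
    (∀ σs : G.MixedProfile,
      MapClusterPt σs Filter.atTop (fun k => G.inducedMixed (γ k)) → G.IsMixedNash σs) := by
  have hpos (k : ℕ) : ∀ i v, 0 < γ k i v := by
    obtain ⟨lam, ν, S⟩ := hγ k
    exact S.pos hG
  have hmem (k : ℕ) : γ k ∈ G.planProfiles := by
    obtain ⟨lam, ν, S⟩ := hγ k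
    exact S.mem_planProfiles hG
  have hle (k : ℕ) (i : N) (p : G.Seq (some i) → ℝ) (hp : p ∈ G.plans (some i)) :
      (1 - t k) * (G.planPayoff i p (γ k) - G.planPayoff i (γ k i) (γ k)) ≤
        t k * ∑ I, ∑ a, (1 + γ₀ i (G.extSeq I a)) := by
    obtain ⟨lam, ν, S⟩ := hγ k
    exact S.mul_sub_planPayoff_le hG hγ₀_pos (ht k).1.le hp
  -- The factor `1 - t k` is kept rather than divided out, as it vanishes when `t k = 1`; it tends
  -- to `1`.
  have hlim {U : Filter ℕ} [U.NeBot] (hU : U ≤ atTop) {f : ℕ → ℝ} {c C : ℝ}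
      (hf : Tendsto f U (nhds c)) (hfC : ∀ k, (1 - t k) * f k ≤ t k * C) : c ≤ 0 := by
    have htU := ht_lim.mono_left hU
    have := le_of_tendsto_of_tendsto ((tendsto_const_nhds (x := (1 : ℝ)).sub htU).mul hf)
      (htU.mul_const C) (Eventually.of_forall hfC)
    simpa using this
  constructor
  · intro γs hγs
    obtain ⟨U, hU, hUγ⟩ := mapClusterPt_iff_ultrafilter.1 hγs
    refine isSequenceFormNash_of_bestResponse hG hγ₀ hγ₀_pos
      (isClosed_planProfiles.mem_of_tendsto hUγ (Eventually.of_forall hmem)) fun i p hp => ?_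
    have h1 : Continuous fun γ : G.PlanProfile =>
        G.planPayoff i p γ - G.planPayoff i (γ i) γ :=
      ((continuous_planPayoff i).comp (by fun_prop : Continuous fun γ : G.PlanProfile => (p, γ))).sub
        ((continuous_planPayoff i).comp
          (by fun_prop : Continuous fun γ : G.PlanProfile => (γ i, γ)))
    exact sub_nonpos.1 (hlim hU ((h1.tendsto γs).comp hUγ) fun k => hle k i p hp)
  · intro σs hσs
    obtain ⟨U, hU, hUσ⟩ := mapClusterPt_iff_ultrafilter.1 hσs
    refine isMixedNash_of_bestResponse (isClosed_mixedProfiles.mem_of_tendsto hUσ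
      (Eventually.of_forall fun k => inducedMixed_mem hG (hmem k) (hpos k))) fun i r => ?_
    have h1 : Continuous fun σ : G.MixedProfile =>
        G.mixedPayoff i r σ - ∑ s, σ i s * G.mixedPayoff i s σ :=
      (continuous_mixedPayoff i r).sub (continuous_finsetSum _ fun s _ =>
        (by fun_prop : Continuous fun σ : G.MixedProfile => σ i s).mul (continuous_mixedPayoff i s))
    -- At each `k` the normal-form regret of `r` equals the sequence-form regret of its plan, so the
    -- same bound applies.
    refine sub_nonpos.1 (hlim (C := ∑ I, ∑ a, (1 + γ₀ i (G.extSeq I a)))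
      hU ((h1.tendsto σs).comp hUσ) fun k => ?_)
    have h2 := hle k i _ (purePlan_mem hG r)
    rw [planPayoff_eq_sum_planMixed hG (hmem k i)] at h2
    simpa only [Function.comp_apply, mixedPayoff_inducedMixed hG (hmem k) (hpos k),
      inducedMixed_eq_planMixed (hpos k)] using h2
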